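/- Let $\mathbb{T}=\{z\in\mathbb{C}:|z|=1\}$. For $0<p<\infty$ let $$\mathbb{T}^H_p=\Big\{(z_n)\in\mathbb{T}^{\infty}:\ \sum_{n}|1-z_n|^p<\infty\Big\},$$ with pointwise multiplication and the topology of the metric $d_p\big((z_n),(w_n)\big)=\big(\sum_n|z_n-w_n|^p\big)^{\min(1,1/p)}$. For a Borel probability measure $\mu$ on a Polish group $X$ and $g\in X$, let $\mu_g(E)=\mu(g^{-1}E)$, and let $E(\mu)$ be the set of all $g\in X$ such that $\mu_g$ and $\mu$ are mutually absolutely continuous. A Polish group $G$ is called a *QI-group* if there are a locally compact Polish group $X$, a continuous injective homomorphism $G\to X$ (by which $G$ is regarded as a subgroup of $X$) and a Borel probability measure $\mu$ on $X$ such that $E(\mu)=G$ and $\mu_g\perp\mu$ for all $g\in X\setminus E(\mu)$; one then says that $G$ is represented in $X$ by $\mu$. **Proposition.** $\mathbb{T}^H_1$ and $\mathbb{T}^H_2$ are (Polish groups and) QI-groups. More precisely, identify $\mathbb{T}$ with $[-\frac12,\frac12)$ through $t\mapsto e^{2\pi i t}$. Then $\mathbb{T}^H_1$, with its inclusion in $\mathbb{T}^\infty$,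 is represented in $\mathbb{T}^{\infty}$ by the product measure $\prod_n\mu_n$ all of whose factors $\mu_n$ have the density $x+1$ with respect to the Haar probability measure of $\mathbb{T}$. For every $c>0$, $\mathbb{T}^H_2$, with its inclusion in $\mathbb{T}^\infty$, is represented in $\mathbb{T}^{\infty}$ by the product measure all of whose factors have the density $\frac1a e^{-c|x|}$, where $a=\frac2c(1-e^{-c/2})$. -/

import Mathlib

open MeasureTheory

/-! ### Groups of quasi-invariance -/

section QI

/-- The shift `μ_g` of a measure by `g`: `μ_g (E) = μ (g⁻¹ E)`. -/
noncomputable def shiftMeasure {X : Type*} [Group X] [MeasurableSpace X]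
    (μ : Measure X) (g : X) : Measure X :=
  μ.map (fun x => g * x)

/-- `E(μ)`: the set of all `g` such that `μ_g` and `μ` are mutually absolutely continuous. -/
def quasiInvarianceSet {X : Type*} [Group X] [MeasurableSpace X] (μ : Measure X) : Set X :=
  {g | shiftMeasure μ g ≪ μ ∧ μ ≪ shiftMeasure μ g}

/-- `G`, embedded in `X` by the continuous monomorphism `ι`, is represented in `X` by `μ`:
`E(μ)` is (the image of) `G`, and `μ_g ⟂ μ` for all `g ∉ E(μ)`. -/
structure IsRepresentedBy {G X : Type*} [Group G] [TopologicalSpace G] [Group X]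
    [TopologicalSpace X] [MeasurableSpace X] (ι : G →* X) (μ : Measure X) : Prop where
  isProbabilityMeasure : IsProbabilityMeasure μ
  continuous : Continuous ι
  injective : Function.Injective ι
  quasiInvarianceSet_eq : quasiInvarianceSet μ = Set.range ι
  mutuallySingular : ∀ g, g ∉ quasiInvarianceSet μ → shiftMeasure μ g ⟂ₘ μ

/-- A QI-group: a Polish group which is represented, by some Borel probability measure, in some
locally compact Polish group. -/
def IsQIGroup (G : Type*) [Group G] [TopologicalSpace G] : Prop :=
  IsTopologicalGroup G ∧ PolishSpace G ∧
    ∃ (X : Type) (_ : Group X) (_ : TopologicalSpace X) (_ : IsTopologicalGroup X)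
      (_ : LocallyCompactSpace X) (_ : PolishSpace X) (_ : MeasurableSpace X) (_ : BorelSpace X)
      (ι : G →* X) (μ : Measure X), IsRepresentedBy ι μ

end QI

/-! ### The groups `𝕋^H_p` -/

section TH

/-- The subgroup of all `(z_n) ∈ 𝕋^∞` with `∑ |1 - z_n| ^ p < ∞`. -/
def THSubgroup (p : ℝ) (hp : 0 < p) : Subgroup (ℕ → Circle) where
  carrier := {z | Summable fun n => ‖(1 : ℂ) - z n‖ ^ p}
  one_mem' := by simp [Real.zero_rpow hp.ne', summable_zero]
  inv_mem' := by
    intro z hz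
    refine (summable_congr fun n => ?_).mp hz
    have h : (1 : ℂ) - ((z⁻¹) n : Circle) = -((z n : ℂ)⁻¹ * (1 - z n)) := by
      have := (z n).coe_ne_zero
      simp only [Pi.inv_apply, Circle.coe_inv]
      field_simp
      ring
    rw [h, norm_neg, norm_mul, norm_inv, Circle.norm_coe, inv_one, one_mul]
  mul_mem' := by
    intro z w hz hw
    refine Summable.of_nonneg_of_le (fun n => by positivity) (fun n => ?_)
      ((hz.add hw).mul_left (2 ^ p))
    have h : ‖(1 : ℂ) - ((z * w) n : Circle)‖ ≤ ‖(1 : ℂ) - z n‖ + ‖(1 : ℂ) - w n‖ := by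
      have : (1 : ℂ) - ((z * w) n : Circle) = (1 - z n) + z n * (1 - w n) := by
        simp only [Pi.mul_apply, Circle.coe_mul]
        ring
      rw [this]
      refine (norm_add_le _ _).trans ?_
      rw [norm_mul, Circle.norm_coe, one_mul]
    set a := ‖(1 : ℂ) - z n‖
    set b := ‖(1 : ℂ) - w n‖
    have ha : 0 ≤ a := norm_nonneg _
    have hb : 0 ≤ b := norm_nonneg _
    calc ‖(1 : ℂ) - ((z * w) n : Circle)‖ ^ p ≤ (2 * max a b) ^ p := by
          refine Real.rpow_le_rpow (norm_nonneg _) (h.trans ?_) hp.le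
          linarith [le_max_left a b, le_max_right a b]
      _ = 2 ^ p * (max a b) ^ p := Real.mul_rpow (by norm_num) (le_max_of_le_left ha)
      _ ≤ 2 ^ p * (a ^ p + b ^ p) := by
          gcongr
          rcases max_choice a b with h | h <;> rw [h]
          · linarith [Real.rpow_nonneg hb p]
          · linarith [Real.rpow_nonneg ha p]

/-- The group `𝕋^H_p`, `0 < p < ∞`. This is a type of its own, since its topology is not the one
induced from `𝕋^∞`. -/
def TH (p : ℝ) (hp : 0 < p) : Type := THSubgroup p hp

namespace TH

variable {p : ℝ} {hp : 0 < p}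

noncomputable instance : CommGroup (TH p hp) := inferInstanceAs (CommGroup (THSubgroup p hp))

/-- The inclusion of `𝕋^H_p` in `𝕋^∞`. -/
noncomputable def toTorus (p : ℝ) (hp : 0 < p) : TH p hp →* (ℕ → Circle) := (THSubgroup p hp).subtype

theorem toTorus_injective : Function.Injective (toTorus p hp) := Subtype.val_injective

theorem range_toTorus :
    Set.range (toTorus p hp) = {z | Summable fun n => ‖(1 : ℂ) - z n‖ ^ p} :=
  Subtype.range_coe

theorem summable_sub (z w : TH p hp) :
    Summable fun n => ‖(toTorus p hp z n : ℂ) - toTorus p hp w n‖ ^ p := by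
  have h : Summable fun n => ‖(1 : ℂ) - toTorus p hp (z⁻¹ * w) n‖ ^ p := (z⁻¹ * w).2
  refine (summable_congr fun n => ?_).mp h
  have h2 : (toTorus p hp z n : ℂ) - toTorus p hp w n
      = toTorus p hp z n * (1 - toTorus p hp (z⁻¹ * w) n) := by
    have := (toTorus p hp z n).coe_ne_zero
    simp only [map_mul, map_inv, Pi.mul_apply, Pi.inv_apply, Circle.coe_mul, Circle.coe_inv]
    field_simp
  rw [h2, norm_mul, Circle.norm_coe, one_mul]

/-- The metric `d_p (z, w) = (∑ |z_n - w_n| ^ p) ^ min (1, 1/p)`. -/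
noncomputable instance : MetricSpace (TH p hp) where
  dist z w := (∑' n, ‖(toTorus p hp z n : ℂ) - toTorus p hp w n‖ ^ p) ^ min 1 (1 / p)
  dist_self z := by
    have h : min 1 (1 / p) ≠ 0 := (lt_min one_pos (by positivity)).ne'
    simp only [sub_self, norm_zero, Real.zero_rpow hp.ne', tsum_zero, Real.zero_rpow h]
  dist_comm z w := by simp only [norm_sub_rev]
  dist_triangle x y z := by
    have hxy := summable_sub x y
    have hyz := summable_sub y z
    have hxz := summable_sub x z
    have htri : ∀ n, ‖(toTorus p hp x n : ℂ) - toTorus p hp z n‖ ≤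
        ‖(toTorus p hp x n : ℂ) - toTorus p hp y n‖ +
          ‖(toTorus p hp y n : ℂ) - toTorus p hp z n‖ :=
      fun n => norm_sub_le_norm_sub_add_norm_sub _ _ _
    rcases le_total 1 p with h1 | h1
    · have hm : min 1 (1 / p) = 1 / p := min_eq_right (by rw [div_le_one hp]; exact h1)
      simp only [hm]
      obtain ⟨hs, hle⟩ := Real.Lp_add_le_tsum_of_nonneg h1
        (fun n => norm_nonneg ((toTorus p hp x n : ℂ) - toTorus p hp y n))
        (fun n => norm_nonneg ((toTorus p hp y n : ℂ) - toTorus p hp z n)) hxy hyz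
      refine le_trans ?_ hle
      refine Real.rpow_le_rpow (tsum_nonneg fun n => by positivity) ?_ (by positivity)
      exact hxz.tsum_le_tsum (fun n => Real.rpow_le_rpow (norm_nonneg _) (htri n) hp.le) hs
    · have hm : min 1 (1 / p) = 1 := min_eq_left (by rw [le_div_iff₀ hp]; linarith)
      simp only [hm, Real.rpow_one]
      rw [← hxy.tsum_add hyz]
      refine hxz.tsum_le_tsum (fun n => ?_) (hxy.add hyz)
      exact (Real.rpow_le_rpow (norm_nonneg _) (htri n) hp.le).trans
        (Real.rpow_add_le_add_rpow (norm_nonneg _) (norm_nonneg _) hp.le h1)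
  eq_of_dist_eq_zero := by
    intro z w h
    have hm : min 1 (1 / p) ≠ 0 := (lt_min one_pos (by positivity)).ne'
    have h0 : ∑' n, ‖(toTorus p hp z n : ℂ) - toTorus p hp w n‖ ^ p = 0 :=
      (Real.rpow_eq_zero (tsum_nonneg fun n => by positivity) hm).mp h
    have h1 := (hasSum_zero_iff_of_nonneg (fun n => by positivity)).mp
      (h0 ▸ (summable_sub z w).hasSum)
    refine toTorus_injective (funext fun n => Circle.ext ?_)
    have h2 := congrFun h1 n
    rw [Pi.zero_apply, Real.rpow_eq_zero (norm_nonneg _) hp.ne', norm_eq_zero] at h2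
    exact sub_eq_zero.mp h2

end TH

end TH

/-! ### Measures on `𝕋` with a given density -/

section Density

/-- `𝕋` carries its Borel σ-algebra. -/
noncomputable instance instMeasurableSpaceCircle : MeasurableSpace Circle := borel Circle

instance instBorelSpaceCircle : BorelSpace Circle := ⟨rfl⟩

/-- The measure on `𝕋`, identified with `[-1/2, 1/2)` through `t ↦ exp (2 π i t)`, whose density
with respect to the Haar probability measure is `f`. -/
noncomputable def circleDensity (f : ℝ → ℝ) : Measure Circle :=
  ((volume.restrict (Set.Ico (-(1 / 2) : ℝ) (1 / 2))).withDensity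
    (fun x => ENNReal.ofReal (f x))).map (fun t => Circle.exp (2 * Real.pi * t))

/-- The density `x + 1`. -/
def linearDensity (x : ℝ) : ℝ := x + 1

/-- The density `a⁻¹ exp (-c |x|)`, where `a = (2 / c) (1 - exp (-c / 2))`. -/
noncomputable def expDensity (c x : ℝ) : ℝ :=
  (2 / c * (1 - Real.exp (-c / 2)))⁻¹ * Real.exp (-c * |x|)

theorem isProbabilityMeasure_circleDensity {f : ℝ → ℝ} (hf : Continuous f)
    (h0 : ∀ x ∈ Set.Ico (-(1 / 2) : ℝ) (1 / 2), 0 ≤ f x)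
    (h1 : ∫ x in (-(1 / 2) : ℝ)..(1 / 2), f x = 1) :
    IsProbabilityMeasure (circleDensity f) := by
  have hm : Measurable fun t : ℝ => Circle.exp (2 * Real.pi * t) :=
    (Circle.exp.continuous.comp (continuous_const.mul continuous_id)).measurable
  constructor
  have hi : IntegrableOn f (Set.Ico (-(1 / 2) : ℝ) (1 / 2)) :=
    (hf.continuousOn.integrableOn_Icc (μ := volume)).mono_set Set.Ico_subset_Icc_self
  rw [circleDensity, Measure.map_apply hm MeasurableSet.univ, Set.preimage_univ,
    withDensity_apply _ MeasurableSet.univ, Measure.restrict_univ,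
    ← ofReal_integral_eq_lintegral_ofReal hi
      ((ae_restrict_iff' measurableSet_Ico).mpr (Filter.Eventually.of_forall h0)),
    integral_Ico_eq_integral_Ioc, ← intervalIntegral.integral_of_le (by norm_num), h1,
    ENNReal.ofReal_one]

theorem isProbabilityMeasure_linearDensity :
    IsProbabilityMeasure (circleDensity linearDensity) := by
  refine isProbabilityMeasure_circleDensity (continuous_id.add continuous_const) ?_ ?_
  · intro x hx
    have := hx.1
    simp only [linearDensity]
    linarith
  · simp only [linearDensity]
    rw [intervalIntegral.integral_add (f := fun x : ℝ => x) (continuous_id.intervalIntegrable _ _) (by simp)]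
    simp
    norm_num

theorem isProbabilityMeasure_expDensity {c : ℝ} (hc : 0 < c) :
    IsProbabilityMeasure (circleDensity (expDensity c)) := by
  have he : Real.exp (-c / 2) < 1 := by
    rw [Real.exp_lt_one_iff]
    linarith
  have hpos : 0 < 2 / c * (1 - Real.exp (-c / 2)) := mul_pos (by positivity) (by linarith)
  have hcont : Continuous (expDensity c) := by unfold expDensity; fun_prop
  refine isProbabilityMeasure_circleDensity hcont ?_ ?_
  · intro x _
    unfold expDensity
    positivity
  · unfold expDensity
    rw [intervalIntegral.integral_const_mul, inv_mul_eq_one₀ hpos.ne']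
    have hg : Continuous fun x : ℝ => Real.exp (-c * |x|) := by fun_prop
    have hR : ∫ x in (0 : ℝ)..(1 / 2), Real.exp (-c * |x|)
        = 1 / c * (1 - Real.exp (-c / 2)) := by
      have h1 : ∫ x in (0 : ℝ)..(1 / 2), Real.exp (-c * |x|)
          = ∫ x in (0 : ℝ)..(1 / 2), Real.exp (-c * x) := by
        refine intervalIntegral.integral_congr fun x hx => ?_
        rw [Set.uIcc_of_le (by norm_num)] at hx
        simp only [abs_of_nonneg hx.1]
      rw [h1, intervalIntegral.integral_comp_mul_left (fun x => Real.exp x) (by linarith : -c ≠ 0),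
        integral_exp, smul_eq_mul, mul_zero, Real.exp_zero,
        show -c * (1 / 2) = -c / 2 by ring, inv_neg]
      ring
    have hL : ∫ x in (-(1 / 2) : ℝ)..0, Real.exp (-c * |x|)
        = 1 / c * (1 - Real.exp (-c / 2)) := by
      rw [← hR]
      have := intervalIntegral.integral_comp_neg (a := 0) (b := 1 / 2)
        (fun x : ℝ => Real.exp (-c * |x|))
      simp only [abs_neg, neg_zero] at this
      exact this.symm
    rw [← intervalIntegral.integral_add_adjacent_intervals (hg.intervalIntegrable _ 0)
      (hg.intervalIntegrable 0 _), hL, hR]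
    ring

end Density

/-!
The theorem rests on Kakutani's dichotomy. The shift of a product measure `∏ μ_n` by `g` is the
product of the shifts of the factors, so it is either equivalent or singular to `∏ μ_n`, and which
of the two holds is decided by a numerical series. When all densities lie between two positive
constants, as here, both Hellinger distances and `χ²` distances are comparable to squared `L²`
distances. Equivalence under summability then follows from a uniform `L²` bound on the densities
of the finite products (`infinitePi_absolutelyContinuous`), applied in both directions, and
singularity from the vanishing of the product of the affinities (`infinitePi_mutuallySingular`).

It remains to compare `∫ (f (x - s) - f x)² dx`, over the circle `ℝ / ℤ`, with
`|1 - exp (2 π i s)| ^ p`, that is with `δ ^ p` where `δ = min s (1 - s)`, `0 ≤ s < 1`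
(`isRepresentedBy_infinitePi_circleDensity`). For `f = x + 1`, which jumps by `1` at the end point
of the fundamental domain, the integral equals `s (1 - s)`, whence `p = 1`. For
`f = exp (-c |x|) / a`, which is Lipschitz on the circle, it is of the order of `δ ^ 2`, whence
`p = 2`.

That `𝕋^H_p` is Polish for `p ≥ 1` is seen by embedding it isometrically, through
`z ↦ (z_n - 1)`, as a closed subset of the separable Banach space `ℓ^p`; it is a topological group
because its metric is invariant.
-/

/-! ### Kakutani's dichotomy for infinite product measures -/

section Kakutani

open ProbabilityTheory Filter Topology
open scoped ENNReal NNReal symmDiff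

theorem lintegral_pi_prod {ι : Type*} [Fintype ι] {X : ι → Type*} [∀ i, MeasurableSpace (X i)]
    (μ : ∀ i, Measure (X i)) [∀ i, IsProbabilityMeasure (μ i)] {φ : ∀ i, X i → ℝ≥0∞}
    (hφ : ∀ i, Measurable (φ i)) :
    ∫⁻ x, ∏ i, φ i (x i) ∂Measure.pi μ = ∏ i, ∫⁻ y, φ i y ∂μ i := by
  rw [lintegral_prod_eq_prod_lintegral_of_indepFun Finset.univ
    (fun i (x : ∀ i, X i) => φ i (x i)) (iIndepFun_pi fun i => (hφ i).aemeasurable)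
    fun i => (hφ i).comp (measurable_pi_apply i)]
  refine Finset.prod_congr rfl fun i _ => ?_
  rw [← (measurePreserving_eval μ i).lintegral_comp (hφ i)]

theorem pi_withDensity {ι : Type*} [Fintype ι] {X : ι → Type*} [∀ i, MeasurableSpace (X i)]
    (μ ν : ∀ i, Measure (X i)) [∀ i, IsProbabilityMeasure (μ i)] [∀ i, IsProbabilityMeasure (ν i)]
    {r : ∀ i, X i → ℝ≥0∞} (hr : ∀ i, Measurable (r i))
    (hν : ∀ i, ν i = (μ i).withDensity (r i)) :
    Measure.pi ν = (Measure.pi μ).withDensity fun x => ∏ i, r i (x i) := by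
  refine Measure.pi_eq fun t ht => ?_
  rw [withDensity_apply _ (MeasurableSet.univ_pi ht),
    ← lintegral_indicator (MeasurableSet.univ_pi ht)]
  have h : ∀ x : ∀ i, X i, (Set.univ.pi t).indicator (fun x => ∏ i, r i (x i)) x
      = ∏ i, (t i).indicator (r i) (x i) := by
    intro x
    by_cases hx : x ∈ Set.univ.pi t
    · rw [Set.indicator_of_mem hx]
      exact Finset.prod_congr rfl fun i _ => (Set.indicator_of_mem (hx i trivial) _).symm
    · rw [Set.indicator_of_notMem hx]
      obtain ⟨i, hi⟩ : ∃ i, x i ∉ t i := by simpa [Set.mem_pi] using hx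
      exact (Finset.prod_eq_zero (Finset.mem_univ i) (Set.indicator_of_notMem hi _)).symm
  simp only [h]
  rw [lintegral_pi_prod μ fun i => (hr i).indicator (ht i)]
  refine Finset.prod_congr rfl fun i _ => ?_
  rw [lintegral_indicator (ht i), hν i, withDensity_apply _ (ht i)]

variable {X : Type*} [MeasurableSpace X] {μ ν : ℕ → Measure X} [∀ n, IsProbabilityMeasure (μ n)]
  [∀ n, IsProbabilityMeasure (ν n)] {r : ℕ → X → ℝ≥0∞}

/-- Half of Kakutani's dichotomy, with `∫ r_n ^ 2` in place of the Hellinger affinities: if the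
densities of the finite products are bounded in `L²`, then `∏ ν_n ≪ ∏ μ_n`. On a cylinder, the
density `L` of the finite product satisfies `L ≤ K + L² / K`, so `Q B ≤ K * P B + C / K`; this
passes to a `P`-null set by approximating it by cylinders, and then `K → ∞`. -/
theorem infinitePi_absolutelyContinuous (hr : ∀ n, Measurable (r n))
    (hν : ∀ n, ν n = (μ n).withDensity (r n)) {C : ℝ≥0}
    (hC : ∀ s : Finset ℕ, ∏ n ∈ s, ∫⁻ x, r n x ^ 2 ∂μ n ≤ C) :
    Measure.infinitePi ν ≪ Measure.infinitePi μ := by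
  set P := Measure.infinitePi μ
  set Q := Measure.infinitePi ν
  have hcyl : ∀ K : ℝ≥0, K ≠ 0 → ∀ B ∈ measurableCylinders fun _ : ℕ => X,
      Q B ≤ K * P B + C / K := by
    intro K hK B hB
    obtain ⟨s, S, hS, rfl⟩ := (mem_measurableCylinders B).mp hB
    rw [Measure.infinitePi_cylinder ν hS, Measure.infinitePi_cylinder μ hS,
      pi_withDensity (fun i : s => μ i) (fun i : s => ν i) (fun i => hr i) (fun i => hν i),
      withDensity_apply _ hS]
    have hL : Measurable fun x : s → X => ∏ i : s, r i (x i) :=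
      Finset.measurable_prod _ fun i _ => (hr i).comp (measurable_pi_apply i)
    have hK' : (K : ℝ≥0∞) ≠ 0 := by simpa using hK
    have hpt : ∀ y : ℝ≥0∞, y ≤ K + y ^ 2 / K := by
      intro y
      rcases le_total y K with h | h
      · exact h.trans le_self_add
      · refine le_trans ?_ le_add_self
        rw [ENNReal.le_div_iff_mul_le (Or.inl hK') (Or.inl ENNReal.coe_ne_top), sq]
        gcongr
    calc ∫⁻ x in S, ∏ i : s, r i (x i) ∂Measure.pi (fun i : s => μ i)
        ≤ ∫⁻ x in S, (K + (∏ i : s, r i (x i)) ^ 2 / K) ∂Measure.pi (fun i : s => μ i) :=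
          lintegral_mono fun x => hpt _
      _ = K * Measure.pi (fun i : s => μ i) S
          + ∫⁻ x in S, (∏ i : s, r i (x i)) ^ 2 / K ∂Measure.pi (fun i : s => μ i) := by
          rw [lintegral_add_left measurable_const, setLIntegral_const]
      _ ≤ K * Measure.pi (fun i : s => μ i) S
          + (∫⁻ x, ∏ i : s, r i (x i) ^ 2 ∂Measure.pi (fun i : s => μ i)) / K := by
          gcongr
          refine (setLIntegral_le_lintegral _ _).trans_eq ?_
          simp only [div_eq_mul_inv, ← Finset.prod_pow]
          rw [lintegral_mul_const _ (by simpa only [Finset.prod_pow] using hL.pow_const 2)]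
      _ ≤ _ := by
          gcongr
          rw [lintegral_pi_prod (fun i : s => μ i) fun i => (hr i).pow_const 2,
            Finset.prod_coe_sort s (fun n => ∫⁻ x, r n x ^ 2 ∂μ n)]
          exact hC s
  refine Measure.AbsolutelyContinuous.mk fun A hA hPA => ?_
  have hK : ∀ K : ℝ≥0, K ≠ 0 → Q A ≤ C / K := by
    intro K hK
    refine ENNReal.le_of_forall_pos_le_add fun ε hε _ => ?_
    -- The approximation is for `P + Q`, so that the cylinder is close to `A` for both measures.
    have hδ : (0 : ℝ≥0∞) < ε / (K + 1) := ENNReal.div_pos (by simpa using hε.ne') (by simp)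
    obtain ⟨B, hB, hBA⟩ := exists_measure_symmDiff_lt_of_generateFrom_isSetRing (μ := P + Q)
      (isSetRing_measurableCylinders (α := fun _ : ℕ => X))
      ⟨{Set.univ}, Set.countable_singleton _, by
        simpa using univ_mem_measurableCylinders (fun _ : ℕ => X), by simp⟩
      generateFrom_measurableCylinders.symm hA hδ
    rw [Measure.add_apply] at hBA
    have hPB : P B ≤ P (B ∆ A) := by
      calc P B ≤ P (B ∆ A ∪ A) := measure_mono fun x hx => by
            by_cases h : x ∈ A
            · exact Or.inr h
            · exact Or.inl (Or.inl ⟨hx, h⟩)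
        _ ≤ P (B ∆ A) + P A := measure_union_le _ _
        _ = _ := by rw [hPA, add_zero]
    calc Q A ≤ Q (B ∆ A ∪ B) := measure_mono fun x hx => by
            by_cases h : x ∈ B
            · exact Or.inr h
            · exact Or.inl (Or.inr ⟨hx, h⟩)
      _ ≤ Q (B ∆ A) + Q B := measure_union_le _ _
      _ ≤ Q (B ∆ A) + (K * P (B ∆ A) + C / K) := by
          gcongr
          exact (hcyl K hK B hB).trans (by gcongr)
      _ = C / K + (1 * Q (B ∆ A) + K * P (B ∆ A)) := by ring
      _ ≤ C / K + ((K + 1) * Q (B ∆ A) + (K + 1) * P (B ∆ A)) := by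
          gcongr
          · exact le_add_self
          · exact le_self_add
      _ = C / K + (K + 1) * (P (B ∆ A) + Q (B ∆ A)) := by ring
      _ ≤ C / K + (K + 1) * (ε / (K + 1)) := by gcongr
      _ = C / K + ε := by rw [ENNReal.mul_div_cancel (by simp) (by finiteness)]
  refine le_antisymm (ge_of_tendsto' (x := atTop) (f := fun n : ℕ => (C : ℝ≥0∞) / (n + 1 : ℕ))
    ?_ fun n => ?_) zero_le
  · have h := (ENNReal.Tendsto.const_mul ENNReal.tendsto_inv_nat_nhds_zero
      (Or.inr (ENNReal.coe_ne_top (r := C)))).comp (tendsto_add_atTop_nat 1)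
    rw [mul_zero] at h
    exact h
  · simpa using hK (n + 1 : ℕ) (by positivity)

/-- The other half of Kakutani's dichotomy: if the Hellinger affinities `∫ √r_n ∂μ_n` multiply
to `0`, then `∏ ν_n` and `∏ μ_n` are mutually singular. With `L` the density of a finite product,
both `P {L ≥ 1}` and `Q {L < 1}` are at most `∫ √L ∂P`, the product of the affinities, so that
no nonzero measure lies below both `P` and `Q`. -/
theorem infinitePi_mutuallySingular (hr : ∀ n, Measurable (r n))
    (hν : ∀ n, ν n = (μ n).withDensity (r n))
    (hρ : Tendsto (fun N => ∏ n ∈ Finset.range N, ∫⁻ x, r n x ^ (1 / 2 : ℝ) ∂μ n) atTop (𝓝 0)) :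
    Measure.infinitePi ν ⟂ₘ Measure.infinitePi μ := by
  refine Measure.mutuallySingular_of_disjoint ?_
  rw [disjoint_iff_inf_le]
  set τ := Measure.infinitePi ν ⊓ Measure.infinitePi μ
  have hτν : τ ≤ Measure.infinitePi ν := inf_le_left
  have hτμ : τ ≤ Measure.infinitePi μ := inf_le_right
  have key : ∀ N, τ Set.univ ≤ 2 * ∏ n ∈ Finset.range N, ∫⁻ x, r n x ^ (1 / 2 : ℝ) ∂μ n := by
    intro N
    set s := Finset.range N
    set L : (s → X) → ℝ≥0∞ := fun x => ∏ i : s, r i (x i)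
    have hL : Measurable L :=
      Finset.measurable_prod _ fun i _ => (hr i).comp (measurable_pi_apply i)
    set R := ∏ n ∈ s, ∫⁻ x, r n x ^ (1 / 2 : ℝ) ∂μ n
    have hR : ∫⁻ x, L x ^ (1 / 2 : ℝ) ∂Measure.pi (fun i : s => μ i) = R := by
      simp only [L, ← ENNReal.prod_rpow_of_nonneg (show (0 : ℝ) ≤ 1 / 2 by norm_num)]
      rw [lintegral_pi_prod (fun i : s => μ i) fun i => (hr i).pow_const (1 / 2 : ℝ),
        Finset.prod_coe_sort s (fun n => ∫⁻ x, r n x ^ (1 / 2 : ℝ) ∂μ n)]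
    have hS : MeasurableSet {x | 1 ≤ L x} := measurableSet_le measurable_const hL
    have h1 : τ (cylinder s {x | 1 ≤ L x}) ≤ R := by
      refine (hτμ _).trans ?_
      rw [Measure.infinitePi_cylinder μ hS, ← hR, ← setLIntegral_one]
      refine (setLIntegral_mono (hL.pow_const _) fun x hx => ?_).trans
        (setLIntegral_le_lintegral _ _)
      exact ENNReal.one_le_rpow hx (by norm_num)
    have h2 : τ (cylinder s {x | 1 ≤ L x}ᶜ) ≤ R := by
      refine (hτν _).trans ?_
      rw [Measure.infinitePi_cylinder ν hS.compl,
        pi_withDensity (fun i : s => μ i) (fun i : s => ν i) (fun i => hr i) (fun i => hν i),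
        withDensity_apply _ hS.compl, ← hR]
      refine (setLIntegral_mono (hL.pow_const _) fun x hx => ?_).trans
        (setLIntegral_le_lintegral _ _)
      refine (ENNReal.rpow_one (L x)).symm.trans_le ?_
      exact ENNReal.rpow_le_rpow_of_exponent_ge (not_le.mp (show ¬1 ≤ L x from hx)).le
        (show (1 / 2 : ℝ) ≤ 1 by norm_num)
    calc τ Set.univ ≤ τ (cylinder s {x | 1 ≤ L x} ∪ cylinder s {x | 1 ≤ L x}ᶜ) :=
          measure_mono fun x _ => em _
      _ ≤ R + R := (measure_union_le _ _).trans (add_le_add h1 h2)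
      _ = 2 * R := (two_mul R).symm
  have h0 : τ Set.univ ≤ 0 := by
    have h := ENNReal.Tendsto.const_mul (a := 2) hρ (Or.inr (by simp))
    rw [mul_zero] at h
    exact ge_of_tendsto' h key
  rw [Measure.measure_univ_eq_zero.mp (le_antisymm h0 zero_le)]
  exact Measure.zero_le _

end Kakutani

/-! ### Product measures with uniformly bounded densities -/

section BoundedDensities

open Filter Topology
open scoped ENNReal NNReal

variable {X : Type*} [MeasurableSpace X] {lam : Measure X}

theorem integrable_of_mem_Icc [IsFiniteMeasure lam] {f : X → ℝ} (hf : Measurable f) {m M : ℝ}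
    (h : ∀ x, f x ∈ Set.Icc m M) : Integrable f lam :=
  Integrable.of_mem_Icc m M hf.aemeasurable (Eventually.of_forall h)

theorem integral_eq_one_of_withDensity {f : X → ℝ} (hf : Measurable f) (h0 : ∀ x, 0 ≤ f x)
    [h : IsProbabilityMeasure (lam.withDensity fun x => ENNReal.ofReal (f x))] :
    ∫ x, f x ∂lam = 1 := by
  have h1 := h.measure_univ
  rw [withDensity_apply _ MeasurableSet.univ, Measure.restrict_univ] at h1
  rw [integral_eq_lintegral_of_nonneg_ae (Eventually.of_forall h0) hf.aestronglyMeasurable, h1,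
    ENNReal.toReal_one]

theorem withDensity_ofReal_div {f g : X → ℝ} (hf : Measurable f) (hg : Measurable g)
    (h0 : ∀ x, 0 < f x) :
    lam.withDensity (fun x => ENNReal.ofReal (g x))
      = (lam.withDensity fun x => ENNReal.ofReal (f x)).withDensity
          fun x => ENNReal.ofReal (g x / f x) := by
  have hq : Measurable fun x => g x / f x := hg.div hf
  rw [← withDensity_mul _ hf.ennreal_ofReal hq.ennreal_ofReal]
  congr 1
  funext x
  rw [Pi.mul_apply, ← ENNReal.ofReal_mul (h0 x).le, mul_div_cancel₀ _ (h0 x).ne']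

variable {f g : X → ℝ} {m M : ℝ} [IsFiniteMeasure lam]

theorem integrable_sub_sq (hf : Measurable f) (hg : Measurable g)
    (hfm : ∀ x, f x ∈ Set.Icc m M) (hgm : ∀ x, g x ∈ Set.Icc m M) :
    Integrable (fun x => (g x - f x) ^ 2) lam := by
  refine integrable_of_mem_Icc ((hg.sub hf).pow_const 2) (m := 0) (M := (M - m) ^ 2) fun x => ?_
  have h1 := hfm x
  have h2 := hgm x
  refine ⟨sq_nonneg _, sq_le_sq' ?_ ?_⟩ <;> linarith [h1.1, h1.2, h2.1, h2.2]

/-- The second moment of `g / f` exceeds `1` by at most the squared `L²` distance of the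
densities, up to a constant: `g² / f = (g - f)² / f + 2 g - f`. -/
theorem lintegral_density_ratio_sq_le (hm : 0 < m) (hf : Measurable f) (hg : Measurable g)
    (hfm : ∀ x, f x ∈ Set.Icc m M) (hgm : ∀ x, g x ∈ Set.Icc m M)
    [IsProbabilityMeasure (lam.withDensity fun x => ENNReal.ofReal (f x))]
    [IsProbabilityMeasure (lam.withDensity fun x => ENNReal.ofReal (g x))] :
    ∫⁻ x, ENNReal.ofReal (g x / f x) ^ 2 ∂(lam.withDensity fun x => ENNReal.ofReal (f x))
      ≤ ENNReal.ofReal (Real.exp ((∫ x, (g x - f x) ^ 2 ∂lam) / m)) := by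
  have hf0 : ∀ x, 0 < f x := fun x => hm.trans_le (hfm x).1
  have hg0 : ∀ x, 0 < g x := fun x => hm.trans_le (hgm x).1
  have hfi : Integrable f lam := integrable_of_mem_Icc hf hfm
  have hgi : Integrable g lam := integrable_of_mem_Icc hg hgm
  have hDi : Integrable (fun x => (g x - f x) ^ 2 / m) lam :=
    (integrable_sub_sq hf hg hfm hgm).div_const m
  have hli : Integrable (fun x => 2 * g x - f x) lam := (hgi.const_mul 2).sub hfi
  have hint : Integrable (fun x => (g x - f x) ^ 2 / m + (2 * g x - f x)) lam :=
    hDi.add hli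
  have hpt : ∀ x, f x * (g x / f x) ^ 2 ≤ (g x - f x) ^ 2 / m + (2 * g x - f x) := by
    intro x
    have h1 : f x * (g x / f x) ^ 2 = (g x - f x) ^ 2 / f x + (2 * g x - f x) := by
      have := (hf0 x).ne'
      field_simp
      ring
    rw [h1]
    have := (hfm x).1
    gcongr
  have hq : Measurable fun x => g x / f x := hg.div hf
  rw [lintegral_withDensity_eq_lintegral_mul _ hf.ennreal_ofReal
    (hq.ennreal_ofReal.pow_const 2)]
  calc ∫⁻ x, _ ∂lam ≤ ∫⁻ x, ENNReal.ofReal ((g x - f x) ^ 2 / m + (2 * g x - f x)) ∂lam := by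
        refine lintegral_mono fun x => ?_
        rw [Pi.mul_apply]
        rw [← ENNReal.ofReal_pow (div_pos (hg0 x) (hf0 x)).le, ← ENNReal.ofReal_mul (hf0 x).le]
        exact ENNReal.ofReal_le_ofReal (hpt x)
    _ = ENNReal.ofReal ((∫ x, (g x - f x) ^ 2 ∂lam) / m + 1) := by
        rw [← ofReal_integral_eq_lintegral_ofReal hint (Eventually.of_forall fun x => ?_),
          integral_add hDi hli, integral_sub (hgi.const_mul 2) hfi,
          integral_const_mul, integral_div,
          integral_eq_one_of_withDensity hf fun x => (hf0 x).le,
          integral_eq_one_of_withDensity hg fun x => (hg0 x).le]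
        · norm_num
        · exact le_trans (mul_nonneg (hf0 x).le (sq_nonneg _)) (hpt x)
    _ ≤ _ := ENNReal.ofReal_le_ofReal (Real.add_one_le_exp _)

/-- The Hellinger affinity `∫ √(f g)` falls short of `1` by at least the squared `L²` distance
of the densities, up to a constant: `√(f g) = (f + g) / 2 - (√g - √f)² / 2`, and
`(√g - √f)² = (g - f)² / (√g + √f)² ≥ (g - f)² / (4 M)`. -/
theorem lintegral_density_ratio_sqrt_le (hm : 0 < m) (hf : Measurable f) (hg : Measurable g)
    (hfm : ∀ x, f x ∈ Set.Icc m M) (hgm : ∀ x, g x ∈ Set.Icc m M)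
    [IsProbabilityMeasure (lam.withDensity fun x => ENNReal.ofReal (f x))]
    [IsProbabilityMeasure (lam.withDensity fun x => ENNReal.ofReal (g x))] :
    ∫⁻ x, ENNReal.ofReal (g x / f x) ^ (1 / 2 : ℝ)
        ∂(lam.withDensity fun x => ENNReal.ofReal (f x))
      ≤ ENNReal.ofReal (Real.exp (-((∫ x, (g x - f x) ^ 2 ∂lam) / (8 * M)))) := by
  have hf0 : ∀ x, 0 < f x := fun x => hm.trans_le (hfm x).1
  have hg0 : ∀ x, 0 < g x := fun x => hm.trans_le (hgm x).1
  have hfi : Integrable f lam := integrable_of_mem_Icc hf hfm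
  have hgi : Integrable g lam := integrable_of_mem_Icc hg hgm
  have hDi : Integrable (fun x => (g x - f x) ^ 2 / (8 * M)) lam :=
    (integrable_sub_sq hf hg hfm hgm).div_const _
  have hSi : Integrable (fun x => (f x + g x) / 2) lam := (hfi.add hgi).div_const 2
  have hint : Integrable (fun x => (f x + g x) / 2 - (g x - f x) ^ 2 / (8 * M)) lam :=
    hSi.sub hDi
  have hpt : ∀ x, f x * √(g x / f x) ≤ (f x + g x) / 2 - (g x - f x) ^ 2 / (8 * M) := by
    intro x
    obtain ⟨a, ha, hfa⟩ : ∃ a : ℝ, 0 < a ∧ f x = a ^ 2 :=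
      ⟨√(f x), Real.sqrt_pos.mpr (hf0 x), (Real.sq_sqrt (hf0 x).le).symm⟩
    obtain ⟨b, hb, hgb⟩ : ∃ b : ℝ, 0 < b ∧ g x = b ^ 2 :=
      ⟨√(g x), Real.sqrt_pos.mpr (hg0 x), (Real.sq_sqrt (hg0 x).le).symm⟩
    have haM : a ^ 2 ≤ M := hfa ▸ (hfm x).2
    have hbM : b ^ 2 ≤ M := hgb ▸ (hgm x).2
    have hM : 0 < M := (by positivity : 0 < a ^ 2).trans_le haM
    have h1 : f x * √(g x / f x) = a * b := by
      rw [hfa, hgb, ← div_pow, Real.sqrt_sq (by positivity)]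
      field_simp
    have h2 : (b ^ 2 - a ^ 2) ^ 2 / (8 * M) ≤ (b - a) ^ 2 / 2 := by
      rw [div_le_div_iff₀ (by positivity) (by positivity)]
      have h3 : (b + a) ^ 2 ≤ 4 * M := by nlinarith [sq_nonneg (b - a)]
      have h4 := mul_le_mul_of_nonneg_left h3 (sq_nonneg (b - a))
      nlinarith
    rw [h1, hfa, hgb]
    linarith [h2]
  have hq : Measurable fun x => g x / f x := hg.div hf
  rw [lintegral_withDensity_eq_lintegral_mul _ hf.ennreal_ofReal
    (hq.ennreal_ofReal.pow_const _)]
  calc ∫⁻ x, _ ∂lam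
      ≤ ∫⁻ x, ENNReal.ofReal ((f x + g x) / 2 - (g x - f x) ^ 2 / (8 * M)) ∂lam := by
        refine lintegral_mono fun x => ?_
        rw [Pi.mul_apply]
        rw [ENNReal.ofReal_rpow_of_nonneg (div_pos (hg0 x) (hf0 x)).le (by norm_num),
          ← ENNReal.ofReal_mul (hf0 x).le, ← Real.sqrt_eq_rpow]
        exact ENNReal.ofReal_le_ofReal (hpt x)
    _ = ENNReal.ofReal (-((∫ x, (g x - f x) ^ 2 ∂lam) / (8 * M)) + 1) := by
        rw [← ofReal_integral_eq_lintegral_ofReal hint (Eventually.of_forall fun x => ?_),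
          integral_sub hSi hDi, integral_div, integral_add hfi hgi, integral_div,
          integral_eq_one_of_withDensity hf fun x => (hf0 x).le,
          integral_eq_one_of_withDensity hg fun x => (hg0 x).le]
        · congr 1
          ring
        · exact le_trans (mul_nonneg (hf0 x).le (Real.sqrt_nonneg _)) (hpt x)
    _ ≤ _ := ENNReal.ofReal_le_ofReal (Real.add_one_le_exp _)

variable {f g : ℕ → X → ℝ}

theorem infinitePi_withDensity_absolutelyContinuous (hm : 0 < m) (hf : ∀ n, Measurable (f n))
    (hg : ∀ n, Measurable (g n)) (hfm : ∀ n x, f n x ∈ Set.Icc m M)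
    (hgm : ∀ n x, g n x ∈ Set.Icc m M)
    [∀ n, IsProbabilityMeasure (lam.withDensity fun x => ENNReal.ofReal (f n x))]
    [∀ n, IsProbabilityMeasure (lam.withDensity fun x => ENNReal.ofReal (g n x))]
    (hs : Summable fun n => ∫ x, (g n x - f n x) ^ 2 ∂lam) :
    Measure.infinitePi (fun n => lam.withDensity fun x => ENNReal.ofReal (g n x)) ≪
      Measure.infinitePi (fun n => lam.withDensity fun x => ENNReal.ofReal (f n x)) := by
  have hf0 : ∀ n x, 0 < f n x := fun n x => hm.trans_le (hfm n x).1
  refine infinitePi_absolutelyContinuous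
    (r := fun n x => ENNReal.ofReal (g n x / f n x))
    (C := (Real.exp (∑' n, (∫ x, (g n x - f n x) ^ 2 ∂lam) / m)).toNNReal)
    (fun n => ((hg n).div (hf n)).ennreal_ofReal)
    (fun n => withDensity_ofReal_div (hf n) (hg n) (hf0 n)) fun s => ?_
  calc _ ≤ ∏ n ∈ s, ENNReal.ofReal (Real.exp ((∫ x, (g n x - f n x) ^ 2 ∂lam) / m)) :=
        Finset.prod_le_prod' fun n _ =>
          lintegral_density_ratio_sq_le hm (hf n) (hg n) (hfm n) (hgm n)
    _ = ENNReal.ofReal (Real.exp (∑ n ∈ s, (∫ x, (g n x - f n x) ^ 2 ∂lam) / m)) := by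
        rw [Real.exp_sum, ENNReal.ofReal_prod_of_nonneg fun n _ => (Real.exp_pos _).le]
    _ ≤ _ := ENNReal.ofReal_le_ofReal (Real.exp_le_exp.mpr
        ((hs.div_const m).sum_le_tsum s fun n _ =>
          div_nonneg (integral_nonneg fun x => sq_nonneg _) hm.le))

theorem infinitePi_withDensity_mutuallySingular (hm : 0 < m) (hM : 0 < M)
    (hf : ∀ n, Measurable (f n))
    (hg : ∀ n, Measurable (g n)) (hfm : ∀ n x, f n x ∈ Set.Icc m M)
    (hgm : ∀ n x, g n x ∈ Set.Icc m M)
    [∀ n, IsProbabilityMeasure (lam.withDensity fun x => ENNReal.ofReal (f n x))]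
    [∀ n, IsProbabilityMeasure (lam.withDensity fun x => ENNReal.ofReal (g n x))]
    (hs : ¬ Summable fun n => ∫ x, (g n x - f n x) ^ 2 ∂lam) :
    Measure.infinitePi (fun n => lam.withDensity fun x => ENNReal.ofReal (g n x)) ⟂ₘ
      Measure.infinitePi (fun n => lam.withDensity fun x => ENNReal.ofReal (f n x)) := by
  have hf0 : ∀ n x, 0 < f n x := fun n x => hm.trans_le (hfm n x).1
  refine infinitePi_mutuallySingular (r := fun n x => ENNReal.ofReal (g n x / f n x))
    (fun n => ((hg n).div (hf n)).ennreal_ofReal)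
    (fun n => withDensity_ofReal_div (hf n) (hg n) (hf0 n)) ?_
  have hsum : Tendsto (fun N => (∑ n ∈ Finset.range N, ∫ x, (g n x - f n x) ^ 2 ∂lam) / (8 * M))
      atTop atTop :=
    ((not_summable_iff_tendsto_nat_atTop_of_nonneg fun n =>
      integral_nonneg fun x => sq_nonneg _).mp hs).atTop_div_const (by positivity)
  have hlim := ENNReal.tendsto_ofReal
    (Real.tendsto_exp_atBot.comp (tendsto_neg_atTop_atBot.comp hsum))
  rw [ENNReal.ofReal_zero] at hlim
  refine tendsto_of_tendsto_of_tendsto_of_le_of_le tendsto_const_nhds hlim (fun _ => zero_le)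
    fun N => ?_
  calc _ ≤ ∏ n ∈ Finset.range N,
          ENNReal.ofReal (Real.exp (-((∫ x, (g n x - f n x) ^ 2 ∂lam) / (8 * M)))) :=
        Finset.prod_le_prod' fun n _ =>
          lintegral_density_ratio_sqrt_le hm (hf n) (hg n) (hfm n) (hgm n)
    _ = _ := by
        rw [← ENNReal.ofReal_prod_of_nonneg fun n _ => (Real.exp_pos _).le, ← Real.exp_sum,
          Finset.sum_neg_distrib, ← Finset.sum_div]
        rfl

end BoundedDensities

/-! ### `𝕋^H_p` as a Polish group -/

section Polish

open scoped ENNReal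

theorem lp_separableSpace {p : ℝ≥0∞} [Fact (1 ≤ p)] (hp : p ≠ ⊤) :
    TopologicalSpace.SeparableSpace (lp (fun _ : ℕ => ℂ) p) := by
  rw [← TopologicalSpace.isSeparable_univ_iff]
  refine (((Set.countable_range fun n : ℕ => lp.single p n (1 : ℂ)).isSeparable.span
    (R := ℂ)).closure).mono fun f _ => ?_
  refine mem_closure_of_tendsto (lp.hasSum_single hp f) (Filter.Eventually.of_forall fun s => ?_)
  refine Submodule.sum_mem _ fun n _ => ?_
  have h : lp.single p n (f n) = f n • lp.single (E := fun _ : ℕ => ℂ) p n (1 : ℂ) := by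
    rw [← lp.single_smul, smul_eq_mul, mul_one]
  rw [h]
  exact Submodule.smul_mem _ _ (Submodule.subset_span ⟨n, rfl⟩)

namespace TH

variable {p : ℝ} {hp : 0 < p}

theorem dist_def (z w : TH p hp) :
    dist z w = (∑' n, ‖(toTorus p hp z n : ℂ) - toTorus p hp w n‖ ^ p) ^ min 1 (1 / p) := rfl

theorem dist_mul_mul_left (x z w : TH p hp) : dist (x * z) (x * w) = dist z w := by
  simp only [dist_def, map_mul, Pi.mul_apply, Circle.coe_mul, ← mul_sub, norm_mul,
    Circle.norm_coe, one_mul]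

theorem dist_inv_inv (z w : TH p hp) : dist z⁻¹ w⁻¹ = dist z w := by
  rw [← dist_mul_mul_left (z * w), mul_inv_cancel_right, mul_right_comm, mul_inv_cancel, one_mul,
    dist_comm]

theorem isTopologicalGroup : IsTopologicalGroup (TH p hp) where
  continuous_mul := by
    refine (LipschitzWith.of_dist_le_mul (K := 2) fun x y => ?_).continuous
    calc dist (x.1 * x.2) (y.1 * y.2)
        ≤ dist (x.1 * x.2) (x.1 * y.2) + dist (x.1 * y.2) (y.1 * y.2) := dist_triangle _ _ _
      _ = dist x.2 y.2 + dist x.1 y.1 := by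
          rw [dist_mul_mul_left, mul_comm x.1, mul_comm y.1, dist_mul_mul_left]
      _ ≤ (2 : NNReal) * dist x y := by
          rw [NNReal.coe_ofNat, two_mul]
          exact add_le_add (le_max_right _ _) (le_max_left _ _)
  continuous_inv := (Isometry.of_dist_eq dist_inv_inv).continuous

theorem continuous_toTorus (hp1 : 1 ≤ p) : Continuous (toTorus p hp) := by
  refine continuous_pi fun n => (LipschitzWith.of_dist_le_mul (K := 1) fun z w => ?_).continuous
  have hm : min 1 (1 / p) = 1 / p := min_eq_right (by rwa [div_le_one hp])
  rw [NNReal.coe_one, one_mul, dist_def, hm]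
  calc dist (toTorus p hp z n) (toTorus p hp w n)
      = (‖(toTorus p hp z n : ℂ) - toTorus p hp w n‖ ^ p) ^ (1 / p) := by
        rw [← Real.rpow_mul (norm_nonneg _), mul_one_div_cancel hp.ne', Real.rpow_one,
          ← dist_eq_norm]
        rfl
    _ ≤ _ := by
        gcongr
        exact (summable_sub z w).le_tsum n fun k _ => by positivity

/-- The embedding `z ↦ (z_n - 1)` of `𝕋^H_p` in the Banach space `ℓ^p`. -/
noncomputable def toLp (p : ℝ) (hp : 0 < p) (z : TH p hp) :
    lp (fun _ : ℕ => ℂ) (ENNReal.ofReal p) :=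
  ⟨fun n => (toTorus p hp z n : ℂ) - 1, by
    refine memℓp_gen ?_
    rw [ENNReal.toReal_ofReal hp.le]
    simpa only [map_one, Pi.one_apply, Circle.coe_one] using summable_sub z 1⟩

theorem toLp_apply (z : TH p hp) (n : ℕ) : toLp p hp z n = (toTorus p hp z n : ℂ) - 1 := rfl

theorem isometry_toLp (hp1 : 1 ≤ p) [Fact (1 ≤ ENNReal.ofReal p)] : Isometry (toLp p hp) := by
  refine Isometry.of_dist_eq fun z w => ?_
  have hm : min 1 (1 / p) = 1 / p := min_eq_right (by rwa [div_le_one hp])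
  rw [dist_eq_norm, lp.norm_eq_tsum_rpow (by rwa [ENNReal.toReal_ofReal hp.le]),
    ENNReal.toReal_ofReal hp.le, dist_def, hm]
  simp only [lp.coeFn_sub, Pi.sub_apply, toLp_apply, sub_sub_sub_cancel_right]

/-- The range consists of the sequences `f` in `ℓ^p` with `|f_n + 1| = 1` for all `n`. -/
theorem isClosed_range_toLp [Fact (1 ≤ ENNReal.ofReal p)] :
    IsClosed (Set.range (toLp p hp)) := by
  have h : Set.range (toLp p hp) = ⋂ n, {f | ‖f n + 1‖ = 1} := by
    ext f
    simp only [Set.mem_range, Set.mem_iInter, Set.mem_ofPred_eq]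
    constructor
    · rintro ⟨z, rfl⟩ n
      rw [toLp_apply, sub_add_cancel, Circle.norm_coe]
    · intro hf
      let z : ℕ → Circle := fun n => ⟨f n + 1, mem_sphere_zero_iff_norm.mpr (hf n)⟩
      have hz : z ∈ THSubgroup p hp := by
        have := (lp.memℓp f).summable (by rwa [ENNReal.toReal_ofReal hp.le])
        rw [ENNReal.toReal_ofReal hp.le] at this
        refine this.congr fun n => ?_
        rw [← norm_neg]
        simp [z]
      refine ⟨⟨z, hz⟩, ?_⟩
      ext n
      show (z n : ℂ) - 1 = f n
      simp [z]
  rw [h]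
  refine isClosed_iInter fun n => isClosed_eq ?_ continuous_const
  have : Continuous fun f : lp (fun _ : ℕ => ℂ) (ENNReal.ofReal p) => f n :=
    (continuous_apply n).comp lp.uniformContinuous_coe.continuous
  exact (this.add continuous_const).norm

theorem polishSpace (hp1 : 1 ≤ p) : PolishSpace (TH p hp) := by
  have : Fact (1 ≤ ENNReal.ofReal p) := ⟨ENNReal.one_le_ofReal.mpr hp1⟩
  have := lp_separableSpace (p := ENNReal.ofReal p) ENNReal.ofReal_ne_top
  exact Topology.IsClosedEmbedding.polishSpace (f := toLp p hp)
    ⟨(isometry_toLp hp1).isEmbedding, isClosed_range_toLp⟩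

end TH

theorem polishSpace_torus : PolishSpace (ℕ → Circle) :=
  let _ := TopologicalSpace.metrizableSpaceMetric (ℕ → Circle)
  inferInstance

theorem isQIGroup_TH {p : ℝ} {hp : 0 < p} (hp1 : 1 ≤ p) {μ : Measure (ℕ → Circle)}
    (h : IsRepresentedBy (TH.toTorus p hp) μ) : IsQIGroup (TH p hp) :=
  ⟨TH.isTopologicalGroup, TH.polishSpace hp1, ℕ → Circle, inferInstance, inferInstance,
    inferInstance, inferInstance, polishSpace_torus, inferInstance, inferInstance,
    TH.toTorus p hp, μ, h⟩

end Polish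

/-! ### Rotating a density on the circle -/

section Rotation

open scoped ENNReal

/-- The coordinate in `[-1/2, 1/2)` of a point of `𝕋`. The inverse is taken so that the value of
`Complex.arg` at `-1`, which is `π`, goes to `-1/2`. -/
noncomputable def circleAngle (z : Circle) : ℝ := -Complex.arg (z⁻¹ : Circle) / (2 * Real.pi)

theorem measurable_circle_exp : Measurable fun t : ℝ => Circle.exp (2 * Real.pi * t) :=
  (Circle.exp.continuous.comp (continuous_const.mul continuous_id)).measurable

theorem measurable_circleAngle : Measurable circleAngle :=
  ((Complex.measurable_arg.comp
    (continuous_subtype_val.comp (continuous_inv (G := Circle))).measurable).neg).div_const _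

theorem circleAngle_mem (z : Circle) : circleAngle z ∈ Set.Ico (-(1 / 2) : ℝ) (1 / 2) := by
  have hπ := Real.pi_pos
  have h1 := Complex.neg_pi_lt_arg (z⁻¹ : Circle)
  have h2 := Complex.arg_le_pi (z⁻¹ : Circle)
  rw [circleAngle]
  constructor
  · rw [le_div_iff₀ (by positivity)]
    linarith
  · rw [div_lt_iff₀ (by positivity)]
    linarith

theorem exp_circleAngle (z : Circle) : Circle.exp (2 * Real.pi * circleAngle z) = z := by
  rw [circleAngle, mul_div_cancel₀ _ (by positivity), Circle.exp_neg, Circle.exp_arg, inv_inv]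

theorem circleAngle_exp {t : ℝ} (ht : t ∈ Set.Ico (-(1 / 2) : ℝ) (1 / 2)) :
    circleAngle (Circle.exp (2 * Real.pi * t)) = t := by
  have hπ := Real.pi_pos
  rw [circleAngle, ← Circle.exp_neg, Circle.arg_exp (by nlinarith [ht.2]) (by nlinarith [ht.1]),
    neg_neg, mul_div_cancel_left₀ _ (by positivity)]

/-- The constant density `1` gives the Haar probability measure, the reference measure for all
densities on the circle. -/
theorem circleDensity_one :
    circleDensity (fun _ => 1) = (volume.restrict (Set.Ico (-(1 / 2) : ℝ) (1 / 2))).map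
      fun t => Circle.exp (2 * Real.pi * t) := by
  simp [circleDensity]

instance : IsProbabilityMeasure (circleDensity fun _ => 1) :=
  isProbabilityMeasure_circleDensity continuous_const (fun _ _ => zero_le_one) (by norm_num)

theorem circleDensity_eq_withDensity {f : ℝ → ℝ} (hf : Measurable f) :
    circleDensity f
      = (circleDensity fun _ => 1).withDensity fun z => ENNReal.ofReal (f (circleAngle z)) := by
  ext A hA
  have hm := measurable_circle_exp
  have hfa : Measurable fun z => f (circleAngle z) := hf.comp measurable_circleAngle
  rw [withDensity_apply _ hA, circleDensity_one, setLIntegral_map hA hfa.ennreal_ofReal hm,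
    circleDensity, Measure.map_apply hm hA,
    withDensity_apply _ (hm hA), Measure.restrict_restrict (hm hA)]
  refine setLIntegral_congr_fun ((hm hA).inter measurableSet_Ico) fun t ht => ?_
  simp only [circleAngle_exp ht.2]

theorem integral_comp_circleAngle {h : ℝ → ℝ} (hh : Measurable h) :
    ∫ z, h (circleAngle z) ∂(circleDensity fun _ => 1)
      = ∫ x in Set.Ico (-(1 / 2) : ℝ) (1 / 2), h x := by
  have hha : Measurable fun z => h (circleAngle z) := hh.comp measurable_circleAngle
  rw [circleDensity_one, integral_map measurable_circle_exp.aemeasurable hha.aestronglyMeasurable]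
  exact setIntegral_congr_fun measurableSet_Ico fun t ht => by simp only [circleAngle_exp ht]

/-- The density on `[-1/2, 1/2)` of the measure with density `f` after a rotation by
`exp (2 π i s)`, `0 ≤ s < 1`. -/
noncomputable def rotateDensity (f : ℝ → ℝ) (s x : ℝ) : ℝ :=
  if x < -(1 / 2) + s then f (x - s + 1) else f (x - s)

theorem measurable_rotateDensity {f : ℝ → ℝ} (hf : Measurable f) (s : ℝ) :
    Measurable (rotateDensity f s) :=
  Measurable.ite measurableSet_Iio (hf.comp (by fun_prop)) (hf.comp (by fun_prop))

theorem rotateDensity_mem {f : ℝ → ℝ} {S : Set ℝ}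
    (hf : ∀ x ∈ Set.Ico (-(1 / 2) : ℝ) (1 / 2), f x ∈ S) {s : ℝ} (hs : s ∈ Set.Ico (0 : ℝ) 1)
    {x : ℝ} (hx : x ∈ Set.Ico (-(1 / 2) : ℝ) (1 / 2)) : rotateDensity f s x ∈ S := by
  obtain ⟨h0, h1⟩ := hs
  obtain ⟨h2, h3⟩ := hx
  rw [rotateDensity]
  split_ifs with h
  · exact hf _ ⟨by linarith, by linarith⟩
  · exact hf _ ⟨by linarith, by linarith⟩

theorem shiftMeasure_circleDensity {f : ℝ → ℝ} {s : ℝ} (hs : s ∈ Set.Ico (0 : ℝ) 1) :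
    shiftMeasure (circleDensity f) (Circle.exp (2 * Real.pi * s))
      = circleDensity (rotateDensity f s) := by
  have hm := measurable_circle_exp
  have hg : Measurable fun z : Circle => Circle.exp (2 * Real.pi * s) * z :=
    (continuous_const_mul _).measurable
  obtain ⟨h0, h1⟩ := hs
  ext A hA
  rw [shiftMeasure, Measure.map_apply hg hA]
  simp only [circleDensity]
  rw [Measure.map_apply hm (hg hA), Measure.map_apply hm hA, withDensity_apply _ (hm (hg hA)),
    withDensity_apply _ (hm hA), Measure.restrict_restrict (hm (hg hA)),
    Measure.restrict_restrict (hm hA)]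
  set B := (fun t : ℝ => Circle.exp (2 * Real.pi * t)) ⁻¹' A
  have hB : MeasurableSet B := hm hA
  have hBs : (fun t : ℝ => Circle.exp (2 * Real.pi * t)) ⁻¹'
      ((fun z => Circle.exp (2 * Real.pi * s) * z) ⁻¹' A) = (fun t => t + s) ⁻¹' B := by
    ext t
    simp only [B, Set.mem_preimage, ← Circle.exp_add]
    rw [show 2 * Real.pi * s + 2 * Real.pi * t = 2 * Real.pi * (t + s) by ring]
  have hper : ∀ t, t - 1 ∈ B ↔ t ∈ B := by
    intro t
    simp only [B, Set.mem_preimage]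
    rw [mul_sub, mul_one, Circle.exp_sub_two_pi]
  rw [hBs]
  have hunion : ∀ c : ℝ, c ∈ Set.Icc (-(1 / 2) : ℝ) (1 / 2) →
      Set.Ico (-(1 / 2) : ℝ) (1 / 2) = Set.Ico (-(1 / 2)) c ∪ Set.Ico c (1 / 2) := fun c hc =>
    (Set.Ico_union_Ico_eq_Ico hc.1 hc.2).symm
  have hdisj : ∀ c : ℝ, Disjoint (Set.Ico (-(1 / 2) : ℝ) c) (Set.Ico c (1 / 2)) := fun c =>
    Set.Ico_disjoint_Ico_same
  rw [hunion (1 / 2 - s) ⟨by linarith, by linarith⟩, Set.inter_union_distrib_left,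
    lintegral_union (((measurable_add_const s) hB).inter measurableSet_Ico)
      ((hdisj _).mono Set.inter_subset_right Set.inter_subset_right),
    Set.Ico_union_Ico_eq_Ico (by linarith) (by linarith),
    hunion (-(1 / 2) + s) ⟨by linarith, by linarith⟩, Set.inter_union_distrib_left,
    lintegral_union (hB.inter measurableSet_Ico)
      ((hdisj _).mono Set.inter_subset_right Set.inter_subset_right), add_comm]
  have htrans : ∀ (c : ℝ) (S : Set ℝ), MeasurableSet S →
      ∫⁻ t in (fun t => t + c) ⁻¹' S, ENNReal.ofReal (f t)
        = ∫⁻ x in S, ENNReal.ofReal (f (x - c)) := by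
    intro c S hS
    have h := (measurePreserving_add_right volume c).setLIntegral_comp_preimage_emb
      (measurableEmbedding_addRight c) (fun x => ENNReal.ofReal (f (x - c))) S
    simpa only [add_sub_cancel_right] using h
  congr 1
  -- The upper part `[1/2 - s, 1/2)` leaves the fundamental domain and returns at its lower end.
  · have hset : (fun t => t + s) ⁻¹' B ∩ Set.Ico (1 / 2 - s) (1 / 2)
        = (fun t => t + (s - 1)) ⁻¹' (B ∩ Set.Ico (-(1 / 2)) (-(1 / 2) + s)) := by
      ext t
      have h : t + (s - 1) ∈ B ↔ t + s ∈ B := by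
        rw [← hper (t + s), add_sub_assoc]
      simp only [Set.mem_inter_iff, Set.mem_preimage, Set.mem_Ico, h]
      refine and_congr_right fun _ => ⟨fun h => ⟨?_, ?_⟩, fun h => ⟨?_, ?_⟩⟩ <;>
        linarith [h.1, h.2]
    rw [hset, htrans _ _ (hB.inter measurableSet_Ico)]
    refine setLIntegral_congr_fun (hB.inter measurableSet_Ico) fun x hx => ?_
    simp only [rotateDensity, if_pos hx.2.2]
    rw [show x - (s - 1) = x - s + 1 by ring]
  · have hset : (fun t => t + s) ⁻¹' B ∩ Set.Ico (-(1 / 2)) (1 / 2 - s)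
        = (fun t => t + s) ⁻¹' (B ∩ Set.Ico (-(1 / 2) + s) (1 / 2)) := by
      ext t
      simp only [Set.mem_inter_iff, Set.mem_preimage, Set.mem_Ico]
      refine and_congr_right fun _ => ⟨fun h => ⟨?_, ?_⟩, fun h => ⟨?_, ?_⟩⟩ <;>
        linarith [h.1, h.2]
    rw [hset, htrans _ _ (hB.inter measurableSet_Ico)]
    refine setLIntegral_congr_fun (hB.inter measurableSet_Ico) fun x hx => ?_
    simp only [rotateDensity, if_neg (not_lt.mpr hx.2.1)]

theorem exists_exp_eq (z : Circle) :
    ∃ s ∈ Set.Ico (0 : ℝ) 1, Circle.exp (2 * Real.pi * s) = z := by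
  obtain ⟨h1, h2⟩ := circleAngle_mem z
  rcases le_or_gt 0 (circleAngle z) with h | h
  · exact ⟨circleAngle z, ⟨h, by linarith⟩, exp_circleAngle z⟩
  · refine ⟨circleAngle z + 1, ⟨by linarith, by linarith⟩, ?_⟩
    rw [mul_add, mul_one, Circle.exp_add_two_pi, exp_circleAngle]

/-- `|1 - exp (2 π i s)|` is comparable to the distance from `s` to the integers. -/
theorem norm_one_sub_circle_exp {s : ℝ} (hs : s ∈ Set.Ico (0 : ℝ) 1) :
    4 * min s (1 - s) ≤ ‖(1 : ℂ) - Circle.exp (2 * Real.pi * s)‖ ∧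
      ‖(1 : ℂ) - Circle.exp (2 * Real.pi * s)‖ ≤ 2 * Real.pi * min s (1 - s) := by
  obtain ⟨h0, h1⟩ := hs
  have hπ := Real.pi_pos
  have hnorm : ‖(1 : ℂ) - Circle.exp (2 * Real.pi * s)‖ = 2 * Real.sin (Real.pi * s) := by
    rw [norm_sub_rev, Circle.coe_exp, mul_comm _ Complex.I, Complex.norm_exp_I_mul_ofReal_sub_one,
      show 2 * Real.pi * s / 2 = Real.pi * s by ring, Real.norm_of_nonneg]
    exact mul_nonneg zero_le_two (Real.sin_nonneg_of_nonneg_of_le_pi (by positivity)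
      (by nlinarith))
  have hsin : Real.sin (Real.pi * s) = Real.sin (Real.pi * min s (1 - s)) := by
    rcases min_choice s (1 - s) with h | h
    · rw [h]
    · rw [h, mul_sub, mul_one, Real.sin_pi_sub]
  have hd0 : 0 ≤ min s (1 - s) := le_min h0 (by linarith)
  have hd1 : min s (1 - s) ≤ 1 / 2 := by
    linarith [min_le_left s (1 - s), min_le_right s (1 - s)]
  rw [hnorm, hsin]
  constructor
  · have h := Real.mul_le_sin (x := Real.pi * min s (1 - s)) (by positivity) (by nlinarith)
    rw [← mul_assoc, div_mul_cancel₀ _ hπ.ne'] at h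
    linarith
  · have h := Real.sin_le (x := Real.pi * min s (1 - s)) (by positivity)
    linarith

end Rotation

/-! ### From an `L²` modulus of continuity to a representation -/

section Representation

open Filter

theorem isProbabilityMeasure_shiftMeasure {X : Type*} [Group X] [MeasurableSpace X]
    [MeasurableMul X] (μ : Measure X) [IsProbabilityMeasure μ] (g : X) :
    IsProbabilityMeasure (shiftMeasure μ g) :=
  Measure.isProbabilityMeasure_map (measurable_const_mul g).aemeasurable

theorem shiftMeasure_infinitePi {X : Type*} [Group X] [MeasurableSpace X] [MeasurableMul X]
    (μ : ℕ → Measure X) [∀ n, IsProbabilityMeasure (μ n)] (g : ℕ → X) :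
    shiftMeasure (Measure.infinitePi μ) g = Measure.infinitePi fun n => shiftMeasure (μ n) (g n) :=
  Measure.infinitePi_map_pi μ fun n => measurable_const_mul (g n)

/-- If the squared `L²` distance between the density `f` and its rotation by `s` is comparable to
the `p`-th power of the distance from `s` to the integers, then the infinite power of the measure
with density `f` represents `𝕋^H_p`. -/
theorem isRepresentedBy_infinitePi_circleDensity {p : ℝ} {hp : 0 < p} (hp1 : 1 ≤ p) {f : ℝ → ℝ}
    (hf : Measurable f) {m M : ℝ} (hm : 0 < m)
    (hfm : ∀ x ∈ Set.Ico (-(1 / 2) : ℝ) (1 / 2), f x ∈ Set.Icc m M)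
    [IsProbabilityMeasure (circleDensity f)] {A B : ℝ} (hA : 0 < A) (hB : 0 < B)
    (hD : ∀ s ∈ Set.Ico (0 : ℝ) 1,
      ∫ x in Set.Ico (-(1 / 2) : ℝ) (1 / 2), (rotateDensity f s x - f x) ^ 2
        ∈ Set.Icc (A * min s (1 - s) ^ p) (B * min s (1 - s) ^ p)) :
    IsRepresentedBy (TH.toTorus p hp) (Measure.infinitePi fun _ : ℕ => circleDensity f) := by
  have hM : 0 < M := by
    have h := hfm 0 ⟨by norm_num, by norm_num⟩
    exact hm.trans_le (h.1.trans h.2)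
  have key : ∀ g : ℕ → Circle,
      let μ := Measure.infinitePi fun _ : ℕ => circleDensity f
      ((Summable fun n => ‖(1 : ℂ) - g n‖ ^ p) → shiftMeasure μ g ≪ μ ∧ μ ≪ shiftMeasure μ g) ∧
      ((¬ Summable fun n => ‖(1 : ℂ) - g n‖ ^ p) → shiftMeasure μ g ⟂ₘ μ) := by
    intro g
    choose s hs hsg using fun n => exists_exp_eq (g n)
    have hr := fun n => measurable_rotateDensity hf (s n)
    have hshift : ∀ n, shiftMeasure (circleDensity f) (g n)
        = circleDensity (rotateDensity f (s n)) := fun n => by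
      rw [← hsg n, shiftMeasure_circleDensity (hs n)]
    have hprob : ∀ n, IsProbabilityMeasure ((circleDensity fun _ => 1).withDensity fun z =>
        ENNReal.ofReal (rotateDensity f (s n) (circleAngle z))) := fun n => by
      rw [← circleDensity_eq_withDensity (hr n), ← hshift n]
      exact isProbabilityMeasure_shiftMeasure _ _
    have hprob' : IsProbabilityMeasure ((circleDensity fun _ => 1).withDensity fun z =>
        ENNReal.ofReal (f (circleAngle z))) := by
      rw [← circleDensity_eq_withDensity hf]
      infer_instance
    have hint : ∀ n, ∫ z, (rotateDensity f (s n) (circleAngle z) - f (circleAngle z)) ^ 2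
        ∂(circleDensity fun _ => 1) ∈
          Set.Icc (A * min (s n) (1 - s n) ^ p) (B * min (s n) (1 - s n) ^ p) := fun n => by
      rw [integral_comp_circleAngle (h := fun x => (rotateDensity f (s n) x - f x) ^ 2)
        (((hr n).sub hf).pow_const 2)]
      exact hD (s n) (hs n)
    have hδ : ∀ n, 0 ≤ min (s n) (1 - s n) := fun n =>
      le_min (hs n).1 (sub_nonneg.mpr (hs n).2.le)
    have hsum : (Summable fun n => ‖(1 : ℂ) - g n‖ ^ p) ↔ Summable fun n => ∫ z,
        (rotateDensity f (s n) (circleAngle z) - f (circleAngle z)) ^ 2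
          ∂(circleDensity fun _ => 1) := by
      have hn := fun n => hsg n ▸ norm_one_sub_circle_exp (hs n)
      constructor
      · intro h
        refine Summable.of_nonneg_of_le (fun n => integral_nonneg fun z => sq_nonneg _)
          (fun n => (hint n).2.trans ?_) (h.mul_left B)
        have h1 := hδ n
        have h2 := (hn n).1
        gcongr
        linarith
      · intro h
        refine Summable.of_nonneg_of_le (fun n => by positivity) (fun n => ?_)
          (h.mul_left ((2 * Real.pi) ^ p / A))
        have h1 := hδ n
        calc ‖(1 : ℂ) - g n‖ ^ p ≤ (2 * Real.pi * min (s n) (1 - s n)) ^ p := by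
              have := (hn n).2
              gcongr
          _ = (2 * Real.pi) ^ p / A * (A * min (s n) (1 - s n) ^ p) := by
              rw [Real.mul_rpow (by positivity) h1]
              field_simp
          _ ≤ _ := by
              have := (hint n).1
              gcongr
    have hfa : Measurable fun z => f (circleAngle z) := hf.comp measurable_circleAngle
    have hra : ∀ n, Measurable fun z => rotateDensity f (s n) (circleAngle z) := fun n =>
      (hr n).comp measurable_circleAngle
    have hfm' : ∀ (_ : ℕ) z, f (circleAngle z) ∈ Set.Icc m M := fun _ z =>
      hfm _ (circleAngle_mem z)
    have hrm : ∀ n z, rotateDensity f (s n) (circleAngle z) ∈ Set.Icc m M := fun n z =>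
      rotateDensity_mem hfm (hs n) (circleAngle_mem z)
    have hμ : shiftMeasure (Measure.infinitePi fun _ : ℕ => circleDensity f) g
        = Measure.infinitePi fun n => (circleDensity fun _ => 1).withDensity fun z =>
            ENNReal.ofReal (rotateDensity f (s n) (circleAngle z)) := by
      rw [shiftMeasure_infinitePi]
      simp only [hshift, fun n => circleDensity_eq_withDensity (hr n)]
    simp only [hμ, hsum]
    rw [circleDensity_eq_withDensity hf]
    refine ⟨fun h => ⟨?_, ?_⟩, fun h => ?_⟩
    · exact infinitePi_withDensity_absolutelyContinuous hm (fun _ => hfa) hra hfm' hrm h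
    · refine infinitePi_withDensity_absolutelyContinuous hm hra (fun _ => hfa) hrm hfm' ?_
      simpa only [sub_sq_comm] using h
    · exact infinitePi_withDensity_mutuallySingular hm hM (fun _ => hfa) hra hfm' hrm h
  have hE : quasiInvarianceSet (Measure.infinitePi fun _ : ℕ => circleDensity f)
      = {z | Summable fun n => ‖(1 : ℂ) - z n‖ ^ p} := by
    ext g
    refine ⟨fun hg => ?_, (key g).1⟩
    by_contra hns
    -- A measure which is both absolutely continuous and singular to `μ_g` is zero, and `μ` is not.
    have h0 := Measure.eq_zero_of_absolutelyContinuous_of_mutuallySingular hg.2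
      ((key g).2 hns).symm
    exact IsProbabilityMeasure.ne_zero _ h0
  exact {
    isProbabilityMeasure := inferInstance
    continuous := TH.continuous_toTorus hp1
    injective := TH.toTorus_injective
    quasiInvarianceSet_eq := hE.trans TH.range_toTorus.symm
    mutuallySingular := fun g hg => (key g).2 (by rwa [hE] at hg) }

end Representation

/-! ### The two densities -/

section Densities

/-- The density `x + 1` has a unit jump at `-1 ∈ 𝕋`, and its squared `L²` distance to its rotation
by `s` is exactly `s (1 - s)`: the exponent is `1`. -/
theorem isRepresentedBy_linearDensity :
    IsRepresentedBy (TH.toTorus 1 one_pos)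
      (Measure.infinitePi fun _ : ℕ => circleDensity linearDensity) := by
  have := isProbabilityMeasure_linearDensity
  have hmeas : Measurable linearDensity := measurable_id.add_const 1
  refine isRepresentedBy_infinitePi_circleDensity le_rfl hmeas
    (m := 1 / 2) (M := 3 / 2) (A := 1 / 2) (B := 1) (by norm_num) (fun x hx => ?_) (by norm_num)
    one_pos fun s hs => ?_
  · unfold linearDensity
    constructor <;> linarith [hx.1, hx.2]
  obtain ⟨h0, h1⟩ := hs
  have hsplit : Set.Ico (-(1 / 2) : ℝ) (1 / 2)
      = Set.Ico (-(1 / 2)) (-(1 / 2) + s) ∪ Set.Ico (-(1 / 2) + s) (1 / 2) :=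
    (Set.Ico_union_Ico_eq_Ico (by linarith) (by linarith)).symm
  have hL : ∀ x ∈ Set.Ico (-(1 / 2) : ℝ) (-(1 / 2) + s),
      (rotateDensity linearDensity s x - linearDensity x) ^ 2 = (1 - s) ^ 2 := fun x hx => by
    rw [rotateDensity, if_pos hx.2, linearDensity, linearDensity]
    ring
  have hR : ∀ x ∈ Set.Ico (-(1 / 2) + s) (1 / 2 : ℝ),
      (rotateDensity linearDensity s x - linearDensity x) ^ 2 = s ^ 2 := fun x hx => by
    rw [rotateDensity, if_neg (not_lt.mpr hx.1), linearDensity, linearDensity]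
    ring
  have hval : ∫ x in Set.Ico (-(1 / 2) : ℝ) (1 / 2),
      (rotateDensity linearDensity s x - linearDensity x) ^ 2 = s * (1 - s) := by
    rw [hsplit, setIntegral_union Set.Ico_disjoint_Ico_same measurableSet_Ico,
      setIntegral_congr_fun measurableSet_Ico hL, setIntegral_congr_fun measurableSet_Ico hR,
      setIntegral_const, setIntegral_const, Real.volume_real_Ico_of_le (by linarith),
      Real.volume_real_Ico_of_le (by linarith), smul_eq_mul, smul_eq_mul]
    · ring
    · exact (integrableOn_congr_fun hL measurableSet_Ico).mpr
        (integrableOn_const (by simp))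
    · exact (integrableOn_congr_fun hR measurableSet_Ico).mpr
        (integrableOn_const (by simp))
  rw [hval, Real.rpow_one]
  rcases le_total s (1 - s) with h | h
  · rw [min_eq_left h]
    constructor <;> nlinarith
  · rw [min_eq_right h]
    constructor <;> nlinarith

theorem abs_exp_neg_sub_exp_neg_le {a b : ℝ} (ha : 0 ≤ a) (hb : 0 ≤ b) :
    |Real.exp (-a) - Real.exp (-b)| ≤ |a - b| := by
  wlog h : a ≤ b generalizing a b
  · rw [abs_sub_comm, abs_sub_comm a]
    exact this hb ha (le_of_not_ge h)
  have h1 : Real.exp (-b) ≤ Real.exp (-a) := Real.exp_le_exp.mpr (by linarith)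
  rw [abs_of_nonneg (sub_nonneg.mpr h1), abs_of_nonpos (by linarith)]
  have h2 : Real.exp (-a) ≤ 1 := Real.exp_le_one_iff.mpr (by linarith)
  have h3 : Real.exp (-b) = Real.exp (-a) * Real.exp (-(b - a)) := by
    rw [← Real.exp_add]
    congr 1
    ring
  have h4 := Real.add_one_le_exp (-(b - a))
  have h5 := Real.exp_pos (-a)
  rw [h3]
  nlinarith

/-- Rotation by `s` changes `|x|` by at most the distance `δ` from `s` to the integers, and on an
interval of length `1/8` at one end of `[-1/2, 1/2)` it lowers `|x|` by at least `δ / 2`. -/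
theorem exists_rotateDensity_expDensity_eq (c : ℝ) {s : ℝ} (hs : s ∈ Set.Ico (0 : ℝ) 1) {x : ℝ}
    (hx : x ∈ Set.Ico (-(1 / 2) : ℝ) (1 / 2)) :
    ∃ y, rotateDensity (expDensity c) s x = expDensity c y ∧
      |(|y| - |x|)| ≤ min s (1 - s) ∧
      ((s ≤ 1 / 2 ∧ 3 / 8 ≤ x) ∨ (1 / 2 ≤ s ∧ x ≤ -(3 / 8)) →
        |y| + min s (1 - s) / 2 ≤ |x|) := by
  obtain ⟨h0, h1⟩ := hs
  obtain ⟨h2, h3⟩ := hx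
  by_cases h : x < -(1 / 2) + s
  · refine ⟨x - s + 1, by rw [rotateDensity, if_pos h], ?_, ?_⟩ <;> grind
  · refine ⟨x - s, by rw [rotateDensity, if_neg h], ?_, ?_⟩ <;> grind

/-- The density `exp (-c |x|) / a` is Lipschitz on the circle, and not constant, so its squared
`L²` distance to its rotation by `s` is of the order of the square of the distance from `s` to the
integers: the exponent is `2`. -/
theorem isRepresentedBy_expDensity {c : ℝ} (hc : 0 < c) :
    IsRepresentedBy (TH.toTorus 2 two_pos)
      (Measure.infinitePi fun _ : ℕ => circleDensity (expDensity c)) := by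
  have := isProbabilityMeasure_expDensity hc
  set k : ℝ := (2 / c * (1 - Real.exp (-c / 2)))⁻¹ with hk
  have hk0 : 0 < k := by
    have : Real.exp (-c / 2) < 1 := Real.exp_lt_one_iff.mpr (by linarith)
    have : 0 < 1 - Real.exp (-c / 2) := by linarith
    positivity
  have hf : ∀ x, expDensity c x = k * Real.exp (-(c * |x|)) := fun x => by
    rw [expDensity, ← hk, neg_mul]
  have hcont : Continuous (expDensity c) := by
    simp only [funext hf]
    fun_prop
  set I := Set.Ico (-(1 / 2) : ℝ) (1 / 2)
  have hbd : ∀ x ∈ I, expDensity c x ∈ Set.Icc (k * Real.exp (-(c / 2))) k := by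
    intro x hx
    have hx' : |x| ≤ 1 / 2 := abs_le.mpr ⟨hx.1, hx.2.le⟩
    rw [hf]
    constructor
    · gcongr
      nlinarith
    · exact mul_le_of_le_one_right hk0.le (Real.exp_le_one_iff.mpr (by
        have := abs_nonneg x
        nlinarith))
  refine isRepresentedBy_infinitePi_circleDensity one_le_two hcont.measurable
    (m := k * Real.exp (-(c / 2))) (M := k) (A := (k * Real.exp (-(c / 2)) * (c / 2)) ^ 2 / 8)
    (B := (k * c) ^ 2) (by positivity) hbd (by positivity) (by positivity) fun s hs => ?_
  rw [Real.rpow_two]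
  set δ := min s (1 - s)
  have hδ0 : 0 ≤ δ := le_min hs.1 (by linarith [hs.2])
  have hmeas : Measurable fun x => (rotateDensity (expDensity c) s x - expDensity c x) ^ 2 :=
    ((measurable_rotateDensity hcont.measurable s).sub hcont.measurable).pow_const 2
  have hup : ∀ x ∈ I,
      (rotateDensity (expDensity c) s x - expDensity c x) ^ 2 ≤ (k * c * δ) ^ 2 := by
    intro x hx
    obtain ⟨y, hy, hyx, -⟩ := exists_rotateDensity_expDensity_eq c hs hx
    rw [hy, hf, hf, ← mul_sub, mul_assoc, mul_pow, mul_pow k]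
    gcongr ?_ * ?_
    rw [sq_le_sq, abs_of_nonneg (show 0 ≤ c * δ by positivity)]
    refine (abs_exp_neg_sub_exp_neg_le (by positivity) (by positivity)).trans ?_
    rw [← mul_sub, abs_mul, abs_of_pos hc]
    gcongr
  have hint : IntegrableOn
      (fun x => (rotateDensity (expDensity c) s x - expDensity c x) ^ 2) I := by
    refine Measure.integrableOn_of_bounded (M := (k * c * δ) ^ 2) (by simp [I])
      hmeas.aestronglyMeasurable ?_
    refine (ae_restrict_iff' measurableSet_Ico).mpr (Filter.Eventually.of_forall fun x hx => ?_)
    rw [Real.norm_of_nonneg (sq_nonneg _)]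
    exact hup x hx
  have hlow : ∀ J : Set ℝ, MeasurableSet J → J ⊆ I → volume.real J = 1 / 8 →
      (∀ x ∈ J, (s ≤ 1 / 2 ∧ 3 / 8 ≤ x) ∨ (1 / 2 ≤ s ∧ x ≤ -(3 / 8))) →
      (k * Real.exp (-(c / 2)) * (c / 2)) ^ 2 / 8 * δ ^ 2
        ≤ ∫ x in I, (rotateDensity (expDensity c) s x - expDensity c x) ^ 2 := by
    intro J hJ hJI hvol hJs
    have hfin : volume J ≠ ⊤ := ((measure_mono hJI).trans_lt (by simp [I])).ne
    calc (k * Real.exp (-(c / 2)) * (c / 2)) ^ 2 / 8 * δ ^ 2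
        = ∫ _ in J, (k * Real.exp (-(c / 2)) * (c / 2 * δ)) ^ 2 := by
          rw [setIntegral_const, hvol, smul_eq_mul]
          ring
      _ ≤ ∫ x in J, (rotateDensity (expDensity c) s x - expDensity c x) ^ 2 := by
          refine setIntegral_mono_on (integrableOn_const hfin) (hint.mono_set hJI) hJ
            fun x hx => ?_
          obtain ⟨y, hy, -, hyx⟩ := exists_rotateDensity_expDensity_eq c hs (hJI hx)
          have hyx := hyx (hJs x hx)
          have h1 := (hbd x (hJI hx)).1
          have h2 : expDensity c x * Real.exp (c / 2 * δ) ≤ expDensity c y := by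
            rw [hf, hf, mul_assoc, ← Real.exp_add]
            gcongr
            nlinarith
          have h3 := Real.add_one_le_exp (c / 2 * δ)
          have h4 : 0 ≤ c / 2 * δ := by positivity
          have h5 : 0 < k * Real.exp (-(c / 2)) := by positivity
          rw [hy]
          gcongr
          nlinarith
      _ ≤ _ := setIntegral_mono_set hint (Filter.Eventually.of_forall fun x => sq_nonneg _)
          hJI.eventuallyLE
  constructor
  · rcases le_total s (1 / 2) with h | h
    · refine hlow (Set.Ico (3 / 8) (1 / 2)) measurableSet_Ico
        (Set.Ico_subset_Ico_left (by norm_num)) ?_ fun x hx => Or.inl ⟨h, hx.1⟩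
      rw [Real.volume_real_Ico_of_le (by norm_num)]
      norm_num
    · refine hlow (Set.Ico (-(1 / 2)) (-(3 / 8))) measurableSet_Ico
        (Set.Ico_subset_Ico_right (by norm_num)) ?_ fun x hx => Or.inr ⟨h, hx.2.le⟩
      rw [Real.volume_real_Ico_of_le (by norm_num)]
      norm_num
  · calc _ ≤ ∫ _ in I, (k * c * δ) ^ 2 :=
          setIntegral_mono_on hint (integrableOn_const (by simp [I])) measurableSet_Ico hup
      _ = (k * c) ^ 2 * δ ^ 2 := by
          rw [setIntegral_const, Real.volume_real_Ico_of_le (by norm_num), smul_eq_mul]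
          ring

end Densities

theorem proposition2 :
    (IsQIGroup (TH 1 one_pos) ∧
      IsRepresentedBy (TH.toTorus 1 one_pos)
        (Measure.infinitePi fun _ : ℕ => circleDensity linearDensity)) ∧
    (IsQIGroup (TH 2 two_pos) ∧
      ∀ c : ℝ, 0 < c →
        IsRepresentedBy (TH.toTorus 2 two_pos)
          (Measure.infinitePi fun _ : ℕ => circleDensity (expDensity c))) :=
  ⟨⟨isQIGroup_TH le_rfl isRepresentedBy_linearDensity, isRepresentedBy_linearDensity⟩,
    isQIGroup_TH one_le_two (isRepresentedBy_expDensity one_pos),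
    fun _ hc => isRepresentedBy_expDensity hc⟩
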